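/- All Banach spaces are over the same field $\mathbb K$ ($\mathbb C$, or more generally $\mathbb R$ or $\mathbb C$); $X^*$ is the dual space and $L(X,Y)$ the space of bounded linear operators. $X\widehat\otimes Y$ denotes the completion of $X\otimes Y$ in the projective norm $\inf\{\sum_k\|x_k\|\,\|y_k\| : w=\sum_k x_k\otimes y_k\}$. Each $u\in X^*\widehat\otimes Y$ induces a nuclear operator $\widetilde u\in L(X,Y)$, where $\widetilde{x'\otimes y}=x'(\cdot)\,y$. The trace on $X^*\widehat\otimes X$ is the continuous linear functional with $\operatorname{trace}(x'\otimes x)=x'(x)$. A *projective tensor quasinorm* $\alpha$ assigns to each element $u$ of each projective tensor product $X\widehat\otimes Y$ of Banach spaces a value $\alpha(u)\in[0,\infty]$ such that: $\alpha(u)=0$ implies $u=0$; $\alpha(au)=|a|\,\alpha(u)$ for scalars $a$ (with $0\cdot\infty=0$); $\alpha(x\otimes y)=\|x\|\,\|y\|$; there is one constant $C>0$ with $\alpha(u+v)\le C(\alpha(u)+\alpha(v))$ for all $X,Y$ and all $u,v\in X\widehat\otimes Y$; and $\alpha((A\otimes B)u)\le\|A\|\,\alpha(u)\,\|B\|$ for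 all bounded operators $A,B$ on the first and second factor. Let $X\widehat\otimes_\alpha Y$ be the set of those $u\in X\widehat\otimes Y$ with $\alpha(u)<\infty$ for which there are $u_n\in X\otimes Y$ with $\alpha(u-u_n)\to0$. The quasinorm $\alpha$ is *complete* if, for all Banach spaces $X,Y$, each $\alpha$-Cauchy sequence in $X\widehat\otimes_\alpha Y$ $\alpha$-converges to an element of $X\widehat\otimes_\alpha Y$. Let $N_\alpha(X,Y)=\{\widetilde u: u\in X^*\widehat\otimes_\alpha Y\}\subset L(X,Y)$ and $N_\alpha(X)=N_\alpha(X,X)$. A Banach space $X$ has the *$\alpha$-lifting property* if for every closed subspace $X_0\subset X$, with quotient map $Q:X\to X/X_0$, and every $z_0\in(X/X_0)^*\widehat\otimes_\alpha (X/X_0)$ there is $z\in(X/X_0)^*\widehat\otimes_\alpha X$ with $Q\circ z=z_0$ and $\operatorname{trace}(z\circ Q)=\operatorname{trace} z_0$. For $0<p<\infty$ and $0<q\le\infty$, the Lorentz space $l_{p,q}$ consists of the null sequences $a$ with $\sum_{n\ge1}(a_n^*)^q\,n^{q/p-1}<\infty$ if $q<\infty$, and with $\sup_{n\ge1} a_n^*\,n^{1/p}<\infty$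 if $q=\infty$, where $a_n^*=\inf_{|J|<n}\sup_{j\notin J}|a_j|$. An operator $T\in L(X,X)$ *has spectral type $l_{p,q}$* if its nonzero eigenvalues have finite algebraic multiplicity and no limit point other than possibly $0$, and the sequence of these eigenvalues, each repeated according to its algebraic multiplicity (and completed by zeros if there are only finitely many), lies in $l_{p,q}$. A space of operators has spectral type $l_{p,q}$ if each of its elements has. **Theorem.** Let $0<p<\infty$ and $0<q\le\infty$, let $\alpha$ be a complete projective tensor quasinorm and let $X$ be a Banach space with the $\alpha$-lifting property. If $N_\alpha(X)$ has spectral type $l_{p,q}$, then $N_\alpha(X/X_0)$ has spectral type $l_{p,q}$ for every closed subspace $X_0\subset X$. -/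

import Mathlib

open scoped ENNReal TensorProduct Topology
open Filter

universe u

noncomputable section

/-! ### The projective tensor product of two Banach spaces -/

section Projective

variable (𝕜 : Type) [RCLike 𝕜]
  (X Y : Type u) [NormedAddCommGroup X] [NormedSpace 𝕜 X] [NormedAddCommGroup Y] [NormedSpace 𝕜 Y]

/-- The algebraic tensor product `X ⊗ Y`, to be equipped with the projective norm. -/
def AlgTensor : Type u := X ⊗[𝕜] Y

instance : AddCommGroup (AlgTensor 𝕜 X Y) := inferInstanceAs (AddCommGroup (X ⊗[𝕜] Y))

instance : Module 𝕜 (AlgTensor 𝕜 X Y) := inferInstanceAs (Module 𝕜 (X ⊗[𝕜] Y))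

variable {X Y}

/-- The elementary tensor `x ⊗ y` in the algebraic tensor product. -/
def AlgTensor.tmul (x : X) (y : Y) : AlgTensor 𝕜 X Y := (x ⊗ₜ[𝕜] y : X ⊗[𝕜] Y)

variable {𝕜}

/-- The set of the numbers `∑ ‖x i‖ ‖y i‖` over all finite representations `w = ∑ x i ⊗ y i`. -/
def AlgTensor.costs (w : AlgTensor 𝕜 X Y) : Set ℝ :=
  {r | ∃ (n : ℕ) (x : Fin n → X) (y : Fin n → Y),
    w = ∑ i, AlgTensor.tmul 𝕜 (x i) (y i) ∧ r = ∑ i, ‖x i‖ * ‖y i‖}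

/-- The projective norm `inf {∑ ‖x i‖ ‖y i‖ : w = ∑ x i ⊗ y i}`. -/
def AlgTensor.projNorm (w : AlgTensor 𝕜 X Y) : ℝ := sInf w.costs

theorem AlgTensor.costs_nonneg {w : AlgTensor 𝕜 X Y} {r : ℝ} (hr : r ∈ w.costs) : 0 ≤ r := by
  obtain ⟨n, x, y, -, rfl⟩ := hr
  positivity

theorem AlgTensor.bddBelow_costs (w : AlgTensor 𝕜 X Y) : BddBelow w.costs :=
  ⟨0, fun _ hr => AlgTensor.costs_nonneg hr⟩

theorem AlgTensor.add_mem_costs {v w : AlgTensor 𝕜 X Y} {r s : ℝ} (hr : r ∈ v.costs)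
    (hs : s ∈ w.costs) : r + s ∈ (v + w).costs := by
  obtain ⟨n, x, y, rfl, rfl⟩ := hr
  obtain ⟨m, x', y', rfl, rfl⟩ := hs
  refine ⟨n + m, Fin.append x x', Fin.append y y', ?_, ?_⟩ <;> simp [Fin.sum_univ_add]

theorem AlgTensor.smul_mem_costs {w : AlgTensor 𝕜 X Y} {r : ℝ} (a : 𝕜) (hr : r ∈ w.costs) :
    ‖a‖ * r ∈ (a • w).costs := by
  obtain ⟨n, x, y, rfl, rfl⟩ := hr
  refine ⟨n, fun i => a • x i, y, ?_, ?_⟩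
  · rw [Finset.smul_sum]
    exact Finset.sum_congr rfl fun i _ => TensorProduct.smul_tmul' (R := 𝕜) a (x i) (y i)
  · rw [Finset.mul_sum]
    exact Finset.sum_congr rfl fun i _ => by rw [norm_smul, mul_assoc]

theorem AlgTensor.costs_nonempty (w : AlgTensor 𝕜 X Y) : w.costs.Nonempty := by
  refine TensorProduct.induction_on (motive := fun w : X ⊗[𝕜] Y =>
    (AlgTensor.costs (𝕜 := 𝕜) (X := X) (Y := Y) w).Nonempty) w ?_ ?_ ?_
  · exact ⟨0, 0, Fin.elim0, Fin.elim0, by simp; rfl, by simp⟩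
  · intro x y
    exact ⟨‖x‖ * ‖y‖, 1, fun _ => x, fun _ => y, by simp; rfl, by simp⟩
  · rintro v w ⟨r, hr⟩ ⟨s, hs⟩
    exact ⟨r + s, AlgTensor.add_mem_costs hr hs⟩

theorem AlgTensor.projNorm_add_le (v w : AlgTensor 𝕜 X Y) :
    (v + w).projNorm ≤ v.projNorm + w.projNorm := by
  refine le_of_forall_pos_le_add fun ε hε => ?_
  obtain ⟨r, hr, hr'⟩ := Real.lt_sInf_add_pos v.costs_nonempty (half_pos hε)
  obtain ⟨s, hs, hs'⟩ := Real.lt_sInf_add_pos w.costs_nonempty (half_pos hε)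
  have := csInf_le (v + w).bddBelow_costs (AlgTensor.add_mem_costs hr hs)
  unfold AlgTensor.projNorm
  linarith

theorem AlgTensor.projNorm_smul_le (a : 𝕜) (w : AlgTensor 𝕜 X Y) :
    (a • w).projNorm ≤ ‖a‖ * w.projNorm := by
  refine le_of_forall_pos_le_add fun ε hε => ?_
  have ha : 0 < ‖a‖ + 1 := by positivity
  obtain ⟨r, hr, hr'⟩ := Real.lt_sInf_add_pos w.costs_nonempty (div_pos hε ha)
  have h1 := csInf_le (a • w).bddBelow_costs (AlgTensor.smul_mem_costs a hr)
  have h2 : ‖a‖ * r ≤ ‖a‖ * (sInf w.costs + ε / (‖a‖ + 1)) := by gcongr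
  have h3 : ‖a‖ * (ε / (‖a‖ + 1)) ≤ ε := by
    rw [mul_div_assoc', div_le_iff₀ ha]
    nlinarith
  unfold AlgTensor.projNorm
  linarith

variable (𝕜 X Y)

/-- The projective norm as a seminorm (that it separates points is not needed to complete). -/
def AlgTensor.projSeminorm : Seminorm 𝕜 (AlgTensor 𝕜 X Y) :=
  Seminorm.ofSMulLE AlgTensor.projNorm
    (le_antisymm (by simpa using AlgTensor.projNorm_smul_le (0 : 𝕜) (0 : AlgTensor 𝕜 X Y))
      (le_csInf (AlgTensor.costs_nonempty _) fun _ hr => AlgTensor.costs_nonneg hr))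
    AlgTensor.projNorm_add_le AlgTensor.projNorm_smul_le

instance : SeminormedAddCommGroup (AlgTensor 𝕜 X Y) :=
  (AlgTensor.projSeminorm 𝕜 X Y).toAddGroupSeminorm.toSeminormedAddCommGroup

instance : NormedSpace 𝕜 (AlgTensor 𝕜 X Y) where
  norm_smul_le := AlgTensor.projNorm_smul_le

/-- The projective tensor product `X ⊗̂ Y`: the completion of `X ⊗ Y` in the projective norm. -/
abbrev ProjTensor : Type u := UniformSpace.Completion (AlgTensor 𝕜 X Y)

/-- The canonical map `X ⊗ Y → X ⊗̂ Y`. -/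
def ProjTensor.ofAlg : AlgTensor 𝕜 X Y →L[𝕜] ProjTensor 𝕜 X Y := UniformSpace.Completion.toComplL

variable {X Y}

theorem AlgTensor.norm_tmul_le (x : X) (y : Y) : ‖AlgTensor.tmul 𝕜 x y‖ ≤ ‖x‖ * ‖y‖ :=
  csInf_le (AlgTensor.bddBelow_costs _) ⟨1, fun _ => x, fun _ => y, by simp, by simp⟩

/-- The bounded bilinear map `(x, y) ↦ x ⊗ y` into the projective tensor product. -/
def ProjTensor.mk : X →L[𝕜] Y →L[𝕜] ProjTensor 𝕜 X Y :=
  LinearMap.mkContinuous₂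
    ((TensorProduct.mk 𝕜 X Y).compr₂ (ProjTensor.ofAlg 𝕜 X Y : AlgTensor 𝕜 X Y →ₗ[𝕜] _)) 1
    fun x y => by
      rw [one_mul]
      refine le_trans (le_of_eq ?_) (AlgTensor.norm_tmul_le 𝕜 x y)
      exact UniformSpace.Completion.norm_coe (AlgTensor.tmul 𝕜 x y)

variable {𝕜}
variable {Z : Type*} [NormedAddCommGroup Z] [NormedSpace 𝕜 Z]

/-- The linear map on `X ⊗ Y` induced by a bounded bilinear map. -/
def AlgTensor.lift (B : X →L[𝕜] Y →L[𝕜] Z) : AlgTensor 𝕜 X Y →ₗ[𝕜] Z :=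
  (TensorProduct.lift B.toLinearMap₁₂ : X ⊗[𝕜] Y →ₗ[𝕜] Z)

theorem AlgTensor.lift_tmul (B : X →L[𝕜] Y →L[𝕜] Z) (x : X) (y : Y) :
    AlgTensor.lift B (AlgTensor.tmul 𝕜 x y) = B x y :=
  TensorProduct.lift.tmul (f' := B.toLinearMap₁₂) x y

theorem AlgTensor.norm_lift_le (B : X →L[𝕜] Y →L[𝕜] Z) (w : AlgTensor 𝕜 X Y) :
    ‖AlgTensor.lift B w‖ ≤ ‖B‖ * ‖w‖ := by
  have key : ∀ r ∈ w.costs, ‖AlgTensor.lift B w‖ ≤ ‖B‖ * r := by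
    rintro r ⟨n, x, y, rfl, rfl⟩
    rw [map_sum, Finset.mul_sum]
    refine norm_sum_le_of_le _ fun i _ => ?_
    rw [AlgTensor.lift_tmul, ← mul_assoc]
    exact B.le_opNorm₂ (x i) (y i)
  refine le_of_forall_pos_le_add fun ε hε => ?_
  have hB : 0 < ‖B‖ + 1 := by positivity
  obtain ⟨r, hr, hr'⟩ := Real.lt_sInf_add_pos w.costs_nonempty (div_pos hε hB)
  have h2 : ‖B‖ * r ≤ ‖B‖ * (sInf w.costs + ε / (‖B‖ + 1)) := by gcongr
  have h3 : ‖B‖ * (ε / (‖B‖ + 1)) ≤ ε := by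
    rw [mul_div_assoc', div_le_iff₀ hB]
    nlinarith
  have h4 := key r hr
  change _ ≤ ‖B‖ * sInf w.costs + ε
  linarith

variable [CompleteSpace Z]

/-- The continuous linear map on `X ⊗̂ Y` induced by a bounded bilinear map. -/
def ProjTensor.lift (B : X →L[𝕜] Y →L[𝕜] Z) : ProjTensor 𝕜 X Y →L[𝕜] Z :=
  ((AlgTensor.lift B).mkContinuous ‖B‖ (AlgTensor.norm_lift_le B)).extend (ProjTensor.ofAlg 𝕜 X Y)

theorem ProjTensor.lift_ofAlg (B : X →L[𝕜] Y →L[𝕜] Z) (w : AlgTensor 𝕜 X Y) :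
    ProjTensor.lift B (ProjTensor.ofAlg 𝕜 X Y w) = AlgTensor.lift B w :=
  ContinuousLinearMap.extend_eq _ UniformSpace.Completion.denseRange_coe
    (UniformSpace.Completion.isUniformInducing_coe _) w

theorem ProjTensor.lift_mk (B : X →L[𝕜] Y →L[𝕜] Z) (x : X) (y : Y) :
    ProjTensor.lift B (ProjTensor.mk 𝕜 x y) = B x y :=
  (ProjTensor.lift_ofAlg B (AlgTensor.tmul 𝕜 x y)).trans (AlgTensor.lift_tmul B x y)

variable {E F : Type u} [NormedAddCommGroup E] [NormedSpace 𝕜 E]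
  [NormedAddCommGroup F] [NormedSpace 𝕜 F]

/-- The map `A ⊗ B : X ⊗̂ Y → E ⊗̂ F`, with `(A ⊗ B) (x ⊗ y) = A x ⊗ B y`. -/
def ProjTensor.map (A : X →L[𝕜] E) (B : Y →L[𝕜] F) : ProjTensor 𝕜 X Y →L[𝕜] ProjTensor 𝕜 E F :=
  ProjTensor.lift ((ProjTensor.mk 𝕜).bilinearComp A B)

/-- The nuclear operator `ũ : E → Y` of `u ∈ E^* ⊗̂ Y`; that of `e' ⊗ y` is `e ↦ e' (e) y`. -/
def ProjTensor.toOperator [CompleteSpace Y] :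
    ProjTensor 𝕜 (StrongDual 𝕜 E) Y →L[𝕜] (E →L[𝕜] Y) :=
  ProjTensor.lift (ContinuousLinearMap.smulRightL 𝕜 E Y)

/-- The trace on `E^* ⊗̂ E`, the continuous linear functional with `trace (e' ⊗ e) = e' (e)`. -/
def ProjTensor.trace : ProjTensor 𝕜 (StrongDual 𝕜 E) E →L[𝕜] 𝕜 :=
  ProjTensor.lift (ContinuousLinearMap.id 𝕜 (StrongDual 𝕜 E))

/-- The composition `B ∘ z ∈ E^* ⊗̂ F` of `z ∈ E^* ⊗̂ Y` and an operator `B : Y → F`. -/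
def ProjTensor.compLeft (B : Y →L[𝕜] F) (z : ProjTensor 𝕜 (StrongDual 𝕜 E) Y) :
    ProjTensor 𝕜 (StrongDual 𝕜 E) F :=
  ProjTensor.map (ContinuousLinearMap.id 𝕜 (StrongDual 𝕜 E)) B z

/-- The composition `z ∘ A ∈ F^* ⊗̂ Y` of an operator `A : F → E` and `z ∈ E^* ⊗̂ Y`: the operator
`A` acts on the first factor through its adjoint `e' ↦ e' ∘ A`. -/
def ProjTensor.compRight (z : ProjTensor 𝕜 (StrongDual 𝕜 E) Y) (A : F →L[𝕜] E) :
    ProjTensor 𝕜 (StrongDual 𝕜 F) Y :=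
  ProjTensor.map (ContinuousLinearMap.precomp 𝕜 A) (ContinuousLinearMap.id 𝕜 Y) z

end Projective

/-! ### Projective tensor quasinorms -/

/-- A projective tensor quasinorm: a `[0, ∞]`-valued function on the elements of all projective
tensor products of Banach spaces. The value `∞` is allowed, and `0 * ∞ = 0`. -/
structure ProjTensorQuasinorm (𝕜 : Type) [RCLike 𝕜] where
  /-- The value `α(w)`. -/
  val : ∀ {X Y : Type u} [NormedAddCommGroup X] [NormedSpace 𝕜 X] [CompleteSpace X]
    [NormedAddCommGroup Y] [NormedSpace 𝕜 Y] [CompleteSpace Y], ProjTensor 𝕜 X Y → ℝ≥0∞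
  eq_zero_of_val_eq_zero : ∀ {X Y : Type u} [NormedAddCommGroup X] [NormedSpace 𝕜 X]
    [CompleteSpace X] [NormedAddCommGroup Y] [NormedSpace 𝕜 Y] [CompleteSpace Y]
    (w : ProjTensor 𝕜 X Y), val w = 0 → w = 0
  val_smul : ∀ {X Y : Type u} [NormedAddCommGroup X] [NormedSpace 𝕜 X]
    [CompleteSpace X] [NormedAddCommGroup Y] [NormedSpace 𝕜 Y] [CompleteSpace Y]
    (a : 𝕜) (w : ProjTensor 𝕜 X Y), val (a • w) = ‖a‖ₑ * val w
  val_mk : ∀ {X Y : Type u} [NormedAddCommGroup X] [NormedSpace 𝕜 X]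
    [CompleteSpace X] [NormedAddCommGroup Y] [NormedSpace 𝕜 Y] [CompleteSpace Y]
    (x : X) (y : Y), val (ProjTensor.mk 𝕜 x y) = ‖x‖ₑ * ‖y‖ₑ
  /-- The quasi-triangle inequality, with one constant for all pairs of spaces. -/
  val_add_le : ∃ C : ℝ, 0 < C ∧ ∀ {X Y : Type u} [NormedAddCommGroup X] [NormedSpace 𝕜 X]
    [CompleteSpace X] [NormedAddCommGroup Y] [NormedSpace 𝕜 Y] [CompleteSpace Y]
    (v w : ProjTensor 𝕜 X Y), val (v + w) ≤ ENNReal.ofReal C * (val v + val w)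
  val_map_le : ∀ {X Y E F : Type u} [NormedAddCommGroup X] [NormedSpace 𝕜 X]
    [CompleteSpace X] [NormedAddCommGroup Y] [NormedSpace 𝕜 Y] [CompleteSpace Y]
    [NormedAddCommGroup E] [NormedSpace 𝕜 E] [CompleteSpace E]
    [NormedAddCommGroup F] [NormedSpace 𝕜 F] [CompleteSpace F]
    (A : X →L[𝕜] E) (B : Y →L[𝕜] F) (w : ProjTensor 𝕜 X Y),
    val (ProjTensor.map A B w) ≤ ‖A‖ₑ * val w * ‖B‖ₑ

namespace ProjTensorQuasinorm

variable {𝕜 : Type} [RCLike 𝕜] (α : ProjTensorQuasinorm.{u} 𝕜)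
  (X Y : Type u) [NormedAddCommGroup X] [NormedSpace 𝕜 X] [CompleteSpace X]
  [NormedAddCommGroup Y] [NormedSpace 𝕜 Y] [CompleteSpace Y]

theorem val_zero : α.val (0 : ProjTensor 𝕜 X Y) = 0 := by
  simpa using α.val_smul (0 : 𝕜) (0 : ProjTensor 𝕜 X Y)

/-- The `α`-projective tensor product `X ⊗̂_α Y`: the elements `w` of `X ⊗̂ Y` with `α(w) < ∞` that
are `α`-limits of sequences in `X ⊗ Y`. In particular `X ⊗ Y` is dense in `X ⊗̂_α Y`. -/
def tensor : Submodule 𝕜 (ProjTensor 𝕜 X Y) where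
  carrier := {w | α.val w < ∞ ∧ ∃ v : ℕ → AlgTensor 𝕜 X Y,
    Tendsto (fun n => α.val (w - ProjTensor.ofAlg 𝕜 X Y (v n))) atTop (𝓝 0)}
  zero_mem' := ⟨by simp [α.val_zero], fun _ => 0, by simp [α.val_zero]⟩
  add_mem' := by
    rintro w w' ⟨hw, v, hv⟩ ⟨hw', v', hv'⟩
    obtain ⟨C, -, hC⟩ := α.val_add_le
    refine ⟨(hC w w').trans_lt (ENNReal.mul_lt_top ENNReal.ofReal_lt_top
      (ENNReal.add_lt_top.2 ⟨hw, hw'⟩)), fun n => v n + v' n, ?_⟩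
    have h := ENNReal.Tendsto.const_mul (a := ENNReal.ofReal C) (hv.add hv')
      (Or.inr ENNReal.ofReal_ne_top)
    rw [add_zero, mul_zero] at h
    refine tendsto_of_tendsto_of_tendsto_of_le_of_le tendsto_const_nhds h (fun _ => zero_le)
      fun n => ?_
    have := hC (w - ProjTensor.ofAlg 𝕜 X Y (v n)) (w' - ProjTensor.ofAlg 𝕜 X Y (v' n))
    rwa [sub_add_sub_comm, ← map_add] at this
  smul_mem' := by
    rintro a w ⟨hw, v, hv⟩
    refine ⟨by simpa only [α.val_smul] using ENNReal.mul_lt_top enorm_lt_top hw,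
      fun n => a • v n, ?_⟩
    have h := ENNReal.Tendsto.const_mul (a := ‖a‖ₑ) hv (Or.inr enorm_ne_top)
    rw [mul_zero] at h
    simpa only [map_smul, ← smul_sub, α.val_smul] using h

/-- The quasinorm `α` is complete if every `α`-Cauchy sequence in an `α`-projective tensor product
`X ⊗̂_α Y` of Banach spaces `α`-converges to an element of `X ⊗̂_α Y`. -/
def IsComplete : Prop :=
  ∀ (X Y : Type u) [NormedAddCommGroup X] [NormedSpace 𝕜 X] [CompleteSpace X]
    [NormedAddCommGroup Y] [NormedSpace 𝕜 Y] [CompleteSpace Y] (w : ℕ → ProjTensor 𝕜 X Y),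
    (∀ n, w n ∈ α.tensor X Y) →
    (∀ ε : ℝ≥0∞, 0 < ε → ∃ N, ∀ m ≥ N, ∀ n ≥ N, α.val (w m - w n) < ε) →
    ∃ w₀ ∈ α.tensor X Y, Tendsto (fun n => α.val (w n - w₀)) atTop (𝓝 0)

/-- The `α`-nuclear operators `N_α(X, Y) ⊆ L(X, Y)`: the image of `X^* ⊗̂_α Y`. -/
def nuclear : Submodule 𝕜 (X →L[𝕜] Y) :=
  (α.tensor (StrongDual 𝕜 X) Y).map
    (ProjTensor.toOperator : ProjTensor 𝕜 (StrongDual 𝕜 X) Y →L[𝕜] (X →L[𝕜] Y)).toLinearMap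

/-- The `α`-lifting property of a Banach space `X`: for every closed subspace `X₀`, with quotient
map `Q : X → X / X₀`, every `z₀ ∈ (X / X₀)^* ⊗̂_α (X / X₀)` lifts to some `z ∈ (X / X₀)^* ⊗̂_α X`
with `Q ∘ z = z₀` and `trace (z ∘ Q) = trace z₀`. -/
def HasLiftingProperty : Prop :=
  ∀ (X₀ : Submodule 𝕜 X) [IsClosed (X₀ : Set X)],
    ∀ z₀ ∈ α.tensor (StrongDual 𝕜 (X ⧸ X₀)) (X ⧸ X₀),
      ∃ z ∈ α.tensor (StrongDual 𝕜 (X ⧸ X₀)) X,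
        ProjTensor.compLeft X₀.mkQL z = z₀ ∧
        ProjTensor.trace (ProjTensor.compRight z X₀.mkQL) = ProjTensor.trace z₀

end ProjTensorQuasinorm

/-! ### Lorentz sequence spaces and spectral type -/

section Spectral

variable {𝕜 : Type} [RCLike 𝕜]

/-- The nonincreasing rearrangement, indexed from `0`:
`a*_{n+1} = inf_{|J| < n + 1} sup_{j ∉ J} |a j|`. -/
def rearrangement (a : ℕ → 𝕜) (n : ℕ) : ℝ≥0∞ :=
  ⨅ (J : Finset ℕ) (_ : J.card < n + 1), ⨆ (j : ℕ) (_ : j ∉ J), ‖a j‖ₑ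

/-- The Lorentz quasinorm: `(∑_{n ≥ 1} (a*_n)^q n^(q/p - 1))^(1/q)` if `q < ∞`, and
`sup_{n ≥ 1} a*_n n^(1/p)` if `q = ∞`. The index `n ≥ 1` is written as `n + 1` with `n : ℕ`. -/
def lorentzNorm (p : ℝ) (q : ℝ≥0∞) (a : ℕ → 𝕜) : ℝ≥0∞ :=
  if q = ∞ then ⨆ n : ℕ, rearrangement a n * ((n + 1 : ℕ) : ℝ≥0∞) ^ (1 / p)
  else (∑' n : ℕ, rearrangement a n ^ q.toReal *
    ((n + 1 : ℕ) : ℝ≥0∞) ^ (q.toReal / p - 1)) ^ (1 / q.toReal)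

/-- The Lorentz space `l_{p,q}` of null sequences of finite Lorentz quasinorm. -/
def MemLorentz (p : ℝ) (q : ℝ≥0∞) (a : ℕ → 𝕜) : Prop :=
  Tendsto a atTop (𝓝 0) ∧ lorentzNorm p q a < ∞

variable {X : Type u} [NormedAddCommGroup X] [NormedSpace 𝕜 X]

/-- `a` is an enumeration of the nonzero eigenvalues of `T`, each of which is of finite algebraic
multiplicity `dim ⋃_k ker (T - μ)^k` and is repeated as often as this multiplicity says. Terms that
are `0` do not count (they fill up the sequence if there are only finitely many eigenvalues). -/
def IsEigenvalueSequence (T : X →L[𝕜] X) (a : ℕ → 𝕜) : Prop :=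
  ∀ μ : 𝕜, μ ≠ 0 → {n : ℕ | a n = μ}.encard =
    (Module.finrank 𝕜 (Module.End.maxGenEigenspace (T : X →ₗ[𝕜] X) μ) : ℕ∞)

/-- `T` has spectral type `l_{p,q}`: its nonzero eigenvalues have finite algebraic multiplicity and
no limit point other than possibly `0`, and the sequence of them, counted with algebraic
multiplicity, lies in `l_{p,q}`. -/
def HasSpectralType (p : ℝ) (q : ℝ≥0∞) (T : X →L[𝕜] X) : Prop :=
  (∀ μ : 𝕜, μ ≠ 0 → FiniteDimensional 𝕜 (Module.End.maxGenEigenspace (T : X →ₗ[𝕜] X) μ)) ∧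
  (∀ μ : 𝕜, μ ≠ 0 → ¬ AccPt μ (𝓟 {ν : 𝕜 | Module.End.HasEigenvalue (T : X →ₗ[𝕜] X) ν})) ∧
  ∃ a : ℕ → 𝕜, IsEigenvalueSequence T a ∧ MemLorentz p q a

/-- A space of operators on `X` has spectral type `l_{p,q}` if each of its elements has. -/
def OperatorsHaveSpectralType (p : ℝ) (q : ℝ≥0∞) (L : Submodule 𝕜 (X →L[𝕜] X)) : Prop :=
  ∀ T ∈ L, HasSpectralType p q T

end Spectral

end

/-! ### Related operators: the nonzero eigenvalues of `f ∘ g` and `g ∘ f` -/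

section Related

variable {K V W : Type*} [Field K] [AddCommGroup V] [Module K V] [AddCommGroup W] [Module K W]
  (f : V →ₗ[K] W) (g : W →ₗ[K] V)

/-! An α-nuclear operator on `X ⧸ X₀` comes from a tensor `z₀`, and the lifting property provides
`z` with `Q ∘ z = z₀`. With `S : X ⧸ X₀ → X` the operator of `z`, the given operator is `Q S`, while
`S Q` is the operator of `z ∘ Q` and so lies in `N_α(X)`; this uses that α-tensor products are
stable under `A ⊗ B` (`map_mem_tensor`). The related operators `S Q` and `Q S` have the same nonzero
eigenvalues with the same algebraic multiplicities, so one eigenvalue sequence serves both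
(`HasSpectralType.comp_swap`). -/

/-- Iterate the intertwining relation `f (g f - μ) = (f g - μ) f`. -/
theorem LinearMap.apply_pow_comp_sub_smul (μ : K) (k : ℕ) (x : V) :
    f (((g ∘ₗ f - μ • 1 : Module.End K V) ^ k) x) =
      ((f ∘ₗ g - μ • 1 : Module.End K W) ^ k) (f x) := by
  induction k generalizing x with
  | zero => simp
  | succ k ih =>
    rw [pow_succ, pow_succ, Module.End.mul_apply, Module.End.mul_apply, ih]
    simp

theorem LinearMap.apply_mem_maxGenEigenspace_comp {μ : K} {x : V}
    (hx : x ∈ Module.End.maxGenEigenspace (g ∘ₗ f) μ) :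
    f x ∈ Module.End.maxGenEigenspace (f ∘ₗ g) μ := by
  rw [Module.End.mem_maxGenEigenspace] at hx ⊢
  obtain ⟨k, hk⟩ := hx
  exact ⟨k, by rw [← LinearMap.apply_pow_comp_sub_smul, hk, map_zero]⟩

/-- The restriction of `f` to generalized eigenspaces of `g ∘ f` and `f ∘ g`. -/
def LinearMap.maxGenEigenspaceComp (μ : K) :
    Module.End.maxGenEigenspace (g ∘ₗ f) μ →ₗ[K] Module.End.maxGenEigenspace (f ∘ₗ g) μ :=
  f.restrict fun _ hx => f.apply_mem_maxGenEigenspace_comp g hx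

/-- The kernel of `f` lies in the generalized eigenspace of `g f` for `0`, which meets the one for
`μ ≠ 0` trivially. -/
theorem LinearMap.maxGenEigenspaceComp_injective {μ : K} (hμ : μ ≠ 0) :
    Function.Injective (f.maxGenEigenspaceComp g μ) := by
  rw [injective_iff_map_eq_zero]
  rintro ⟨x, hx⟩ h
  have hfx : f x = 0 := congrArg Subtype.val h
  have hx0 : x ∈ Module.End.maxGenEigenspace (g ∘ₗ f) 0 :=
    Module.End.mem_maxGenEigenspace _ _ _ |>.2 ⟨1, by simp [hfx]⟩
  have := (Module.End.disjoint_genEigenspace (g ∘ₗ f) hμ ⊤ ⊤).le_bot ⟨hx, hx0⟩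
  exact Subtype.ext ((Submodule.mem_bot K).1 this)

theorem Module.End.hasEigenvalue_comp_of_ne_zero {μ : K} (hμ : μ ≠ 0)
    (h : Module.End.HasEigenvalue (g ∘ₗ f) μ) : Module.End.HasEigenvalue (f ∘ₗ g) μ := by
  obtain ⟨x, hx⟩ := h.exists_hasEigenvector
  have hgf : g (f x) = μ • x := hx.apply_eq_smul
  refine Module.End.hasEigenvalue_of_hasEigenvector (x := f x)
    ⟨Module.End.mem_eigenspace_iff.2 ?_, fun h0 => ?_⟩
  · rw [LinearMap.comp_apply, hgf, map_smul]
  · rw [h0, map_zero] at hgf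
    exact (smul_ne_zero hμ hx.2) hgf.symm

end Related

/-! ### Transfer of spectral type between related operators -/

section SpectralRelated

variable {𝕜 : Type} [RCLike 𝕜] {X Y : Type u} [NormedAddCommGroup X] [NormedSpace 𝕜 X]
  [NormedAddCommGroup Y] [NormedSpace 𝕜 Y]

/-- For `μ ≠ 0`, `A` and `B` embed the generalized eigenspaces of `B A` and `A B` into each other,
so their dimensions agree and the sequence `a` can be kept. -/
theorem HasSpectralType.comp_swap {p : ℝ} {q : ℝ≥0∞} {A : X →L[𝕜] Y} {B : Y →L[𝕜] X}
    (h : HasSpectralType p q (B ∘L A)) : HasSpectralType p q (A ∘L B) := by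
  obtain ⟨hfin, hacc, a, ha, hmem⟩ := h
  have hfin' : ∀ μ : 𝕜, μ ≠ 0 → FiniteDimensional 𝕜
      (Module.End.maxGenEigenspace ((A ∘L B : Y →L[𝕜] Y) : Y →ₗ[𝕜] Y) μ) := fun μ hμ =>
    have : FiniteDimensional 𝕜
        (Module.End.maxGenEigenspace ((B : Y →ₗ[𝕜] X) ∘ₗ (A : X →ₗ[𝕜] Y)) μ) := hfin μ hμ
    FiniteDimensional.of_injective _
      ((B : Y →ₗ[𝕜] X).maxGenEigenspaceComp_injective (A : X →ₗ[𝕜] Y) hμ)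
  refine ⟨hfin', fun μ hμ hacc' => hacc μ hμ ?_, a, fun μ hμ => ?_, hmem⟩
  · rw [accPt_iff_frequently] at hacc' ⊢
    -- Only nonzero eigenvalues transfer, so the accumulation is tested in the neighbourhood `{ν ≠
    -- 0}` of `μ`.
    refine (hacc'.and_eventually (isOpen_ne.mem_nhds hμ)).mono ?_
    rintro ν ⟨⟨hνμ, hν⟩, hν0⟩
    exact ⟨hνμ, Module.End.hasEigenvalue_comp_of_ne_zero (B : Y →ₗ[𝕜] X) (A : X →ₗ[𝕜] Y) hν0 hν⟩
  -- Comparing `finrank` along an injection needs a finite-dimensional target, here in both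
  -- directions.
  · have := hfin μ hμ
    have := hfin' μ hμ
    rw [ha μ hμ]
    exact congrArg _ (le_antisymm
      (LinearMap.finrank_le_finrank_of_injective
        ((A : X →ₗ[𝕜] Y).maxGenEigenspaceComp_injective (B : Y →ₗ[𝕜] X) hμ))
      (LinearMap.finrank_le_finrank_of_injective
        ((B : Y →ₗ[𝕜] X).maxGenEigenspaceComp_injective (A : X →ₗ[𝕜] Y) hμ)))

end SpectralRelated

/-! ### Composition of tensors and of operators -/

section Composition

variable {𝕜 : Type} [RCLike 𝕜] {X Y E F : Type u} [NormedAddCommGroup X] [NormedSpace 𝕜 X]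
  [NormedAddCommGroup Y] [NormedSpace 𝕜 Y] [NormedAddCommGroup E] [NormedSpace 𝕜 E]
  [NormedAddCommGroup F] [NormedSpace 𝕜 F]

/-- Continuous linear maps on `X ⊗̂ Y` that agree on elementary tensors are equal. -/
theorem ProjTensor.ext_mk {Z : Type*} [NormedAddCommGroup Z] [NormedSpace 𝕜 Z]
    {f g : ProjTensor 𝕜 X Y →L[𝕜] Z}
    (h : ∀ x y, f (ProjTensor.mk 𝕜 x y) = g (ProjTensor.mk 𝕜 x y)) : f = g := by
  refine ContinuousLinearMap.ext fun w => ?_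
  refine UniformSpace.Completion.induction_on w (isClosed_eq f.continuous g.continuous) fun v => ?_
  change f (ProjTensor.ofAlg 𝕜 X Y v) = g (ProjTensor.ofAlg 𝕜 X Y v)
  refine TensorProduct.induction_on (motive := fun v : X ⊗[𝕜] Y =>
    f (ProjTensor.ofAlg 𝕜 X Y v) = g (ProjTensor.ofAlg 𝕜 X Y v)) v ?_ h ?_
  · exact (congrArg f (map_zero (ProjTensor.ofAlg 𝕜 X Y))).trans ((map_zero f).trans
      ((map_zero g).symm.trans (congrArg g (map_zero (ProjTensor.ofAlg 𝕜 X Y)).symm)))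
  · intro v w hv hw
    have e := map_add (ProjTensor.ofAlg 𝕜 X Y) v w
    exact (congrArg f e).trans ((map_add f _ _).trans ((congrArg₂ (· + ·) hv hw).trans
      ((map_add g _ _).symm.trans (congrArg g e.symm))))

theorem ProjTensor.map_mk (A : X →L[𝕜] E) (B : Y →L[𝕜] F) (x : X) (y : Y) :
    ProjTensor.map A B (ProjTensor.mk 𝕜 x y) = ProjTensor.mk 𝕜 (A x) (B y) :=
  ProjTensor.lift_mk _ x y

/-- Ensures that `A ⊗ B` carries algebraic approximants to algebraic approximants. -/
theorem ProjTensor.map_ofAlg_mem_range (A : X →L[𝕜] E) (B : Y →L[𝕜] F) (v : AlgTensor 𝕜 X Y) :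
    ∃ v' : AlgTensor 𝕜 E F,
      ProjTensor.map A B (ProjTensor.ofAlg 𝕜 X Y v) = ProjTensor.ofAlg 𝕜 E F v' := by
  -- Only the finite representation of `v` matters here; its cost is discarded.
  obtain ⟨-, n, x, y, rfl, -⟩ := v.costs_nonempty
  refine ⟨∑ i, AlgTensor.tmul 𝕜 (A (x i)) (B (y i)), ?_⟩
  simp only [map_sum]
  exact Finset.sum_congr rfl fun i _ => ProjTensor.map_mk A B (x i) (y i)

theorem ProjTensor.toOperator_mk [CompleteSpace Y] (e : StrongDual 𝕜 E) (y : Y) :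
    ProjTensor.toOperator (ProjTensor.mk 𝕜 e y) = e.smulRight y :=
  ProjTensor.lift_mk _ e y

theorem ProjTensor.toOperator_compLeft [CompleteSpace Y] [CompleteSpace F] (B : Y →L[𝕜] F)
    (z : ProjTensor 𝕜 (StrongDual 𝕜 E) Y) :
    ProjTensor.toOperator (ProjTensor.compLeft B z) = B ∘L ProjTensor.toOperator z := by
  have : ProjTensor.toOperator ∘L ProjTensor.map (ContinuousLinearMap.id 𝕜 (StrongDual 𝕜 E)) B =
      ContinuousLinearMap.postcomp E B ∘L ProjTensor.toOperator := by
    refine ProjTensor.ext_mk fun e y => ?_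
    ext x
    simp [ProjTensor.map_mk, ProjTensor.toOperator_mk]
  exact congrArg (fun f => f z) this

theorem ProjTensor.toOperator_compRight [CompleteSpace Y] (z : ProjTensor 𝕜 (StrongDual 𝕜 E) Y)
    (A : F →L[𝕜] E) :
    ProjTensor.toOperator (ProjTensor.compRight z A) = ProjTensor.toOperator z ∘L A := by
  have : ProjTensor.toOperator ∘L
        ProjTensor.map (ContinuousLinearMap.precomp 𝕜 A) (ContinuousLinearMap.id 𝕜 Y) =
      ContinuousLinearMap.precomp Y A ∘L ProjTensor.toOperator := by
    refine ProjTensor.ext_mk fun e y => ?_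
    ext x
    simp [ProjTensor.map_mk, ProjTensor.toOperator_mk]
  exact congrArg (fun f => f z) this

/-- The bound `α((A ⊗ B) u) ≤ ‖A‖ α(u) ‖B‖` is applied to `w`, for finiteness, and to the errors `w
- v n`, for approximation. -/
theorem ProjTensorQuasinorm.map_mem_tensor [CompleteSpace X] [CompleteSpace Y] [CompleteSpace E]
    [CompleteSpace F] (α : ProjTensorQuasinorm.{u} 𝕜) (A : X →L[𝕜] E) (B : Y →L[𝕜] F)
    {w : ProjTensor 𝕜 X Y} (hw : w ∈ α.tensor X Y) : ProjTensor.map A B w ∈ α.tensor E F := by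
  obtain ⟨hw, v, hv⟩ := hw
  choose v' hv' using fun n => ProjTensor.map_ofAlg_mem_range A B (v n)
  refine ⟨(α.val_map_le A B w).trans_lt
    (ENNReal.mul_lt_top (ENNReal.mul_lt_top enorm_lt_top hw) enorm_lt_top), v', ?_⟩
  have h := ENNReal.Tendsto.mul_const (b := ‖B‖ₑ) (ENNReal.Tendsto.const_mul (a := ‖A‖ₑ) hv
    (Or.inr enorm_ne_top)) (Or.inr enorm_ne_top)
  rw [mul_zero, zero_mul] at h
  refine tendsto_of_tendsto_of_tendsto_of_le_of_le tendsto_const_nhds h (fun _ => zero_le)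
    fun n => ?_
  have := α.val_map_le A B (w - ProjTensor.ofAlg 𝕜 X Y (v n))
  rwa [map_sub, hv'] at this

end Composition

theorem mainTheorem8 {𝕜 : Type} [RCLike 𝕜] (α : ProjTensorQuasinorm.{u} 𝕜) (hα : α.IsComplete)
    (X : Type u) [NormedAddCommGroup X] [NormedSpace 𝕜 X] [CompleteSpace X]
    (hX : α.HasLiftingProperty X)
    (p : ℝ) (hp : 0 < p) (q : ℝ≥0∞) (hq : 0 < q)
    (hN : OperatorsHaveSpectralType p q (α.nuclear X X))
    (X₀ : Submodule 𝕜 X) [IsClosed (X₀ : Set X)] :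
    OperatorsHaveSpectralType p q (α.nuclear (X ⧸ X₀) (X ⧸ X₀)) := by
  rintro _ ⟨z₀, hz₀, rfl⟩
  obtain ⟨z, hz, hQz, -⟩ := hX X₀ z₀ hz₀
  have hQS : ProjTensor.toOperator z₀ = X₀.mkQL ∘L ProjTensor.toOperator z := by
    rw [← hQz, ProjTensor.toOperator_compLeft]
  -- The tensor `z ∘ Q` witnesses that `S Q` is α-nuclear on `X`.
  have hSQ := hN (ProjTensor.toOperator z ∘L X₀.mkQL)
    ⟨ProjTensor.compRight z X₀.mkQL, α.map_mem_tensor _ _ hz, ProjTensor.toOperator_compRight z _⟩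
  change HasSpectralType p q (ProjTensor.toOperator z₀)
  rw [hQS]
  exact hSQ.comp_swap
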